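/- Let $(X,d)$ be a metric space and $1\le p<\infty$. For a function $u:X\to[0,1]$ (a fuzzy set in $X$) put $[u]_\alpha=\{x\in X:u(x)\ge\alpha\}$ for $\alpha\in(0,1]$ and $[u]_0=\overline{\{x\in X:u(x)>0\}}$, and let $\operatorname{end}u=\{(x,t)\in X\times[0,1]:u(x)\ge t\}$. Let $F^1_{USCG}(X)$ be the set of all $u:X\to[0,1]$ such that $[u]_\alpha$ is nonempty and compact for every $\alpha\in(0,1]$. Write $H$ for the ($[0,+\infty]$-valued) Hausdorff distance between nonempty closed sets, in $X$ or in $X\times[0,1]$ with the metric $\overline d((x,s),(y,t))=d(x,y)+|s-t|$. For $u,v\in F^1_{USCG}(X)$ let $$H_{\rm end}(u,v)=H(\operatorname{end}u,\operatorname{end}v),\qquad d_p(u,v)=\Big(\int_0^1H([u]_\alpha,[v]_\alpha)^p\,d\alpha\Big)^{1/p},$$ and let $F^1_{USCG}(X)^p$ be the set of all $u\in F^1_{USCG}(X)$ with $d_p(u,\chi_{\{x_0\}})<+\infty$ for some (equivalently, every) $x_0\in X$, where $\chi_{\{x_0\}}$ is the characteristic function of $\{x_0\}$. A set $U\subseteq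 F^1_{USCG}(X)^p$ is called $p$-mean equi-left-continuous if for every $\varepsilon>0$ there is a $\delta\in(0,1]$ such that $$\Big(\int_h^1H([u]_\alpha,[u]_{\alpha-h})^p\,d\alpha\Big)^{1/p}<\varepsilon\qquad\text{for all }h\in[0,\delta)\text{ and all }u\in U.$$ For $\alpha\in(0,1]$ put $U(\alpha)=\bigcup_{u\in U}[u]_\alpha$. **Theorem.** Let $U\subseteq F^1_{USCG}(X)^p$. Then the following four conditions are equivalent: 1. $U$ is compact in $(F^1_{USCG}(X)^p,d_p)$; 2. $U$ is compact in $(F^1_{USCG}(X),H_{\rm end})$ and $U$ is $p$-mean equi-left-continuous; 3. $U(\alpha)$ is relatively compact in $X$ (i.e. has compact closure) for every $\alpha\in(0,1]$, $U$ is $p$-mean equi-left-continuous, and $U$ is closed in $(F^1_{USCG}(X)^p,d_p)$; 4. $U(\alpha)$ is compact in $X$ for every $\alpha\in(0,1]$, $U$ is $p$-mean equi-left-continuous, and $U$ is closed in $(F^1_{USCG}(X)^p,d_p)$. -/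

import Mathlib

open scoped ENNReal

namespace FuzzySpace

/-- A fuzzy set in `X`: a function from `X` to the unit interval `[0,1]`. -/
def FuzzySet (X : Type*) : Type _ := X → unitInterval

open Classical in
/-- The fuzzy set `χ_S` corresponding to an ordinary subset `S` of `X`. -/
noncomputable def crisp {X : Type*} (S : Set X) : FuzzySet X :=
  fun x => if x ∈ S then 1 else 0

open Classical in
/-- The `α`-cut `[u]_α` of a fuzzy set, for `α ∈ [0,1]`: the set `{x | u x ≥ α}` if `α ∈ (0,1]`,
and the support, i.e. the closure of `{x | u x > 0}`, if `α = 0`. -/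
noncomputable def cut {X : Type*} [TopologicalSpace X] (u : FuzzySet X) (α : ℝ) : Set X :=
  if α = 0 then closure {x | (0 : ℝ) < (u x : ℝ)} else {x | α ≤ (u x : ℝ)}

/-- The endograph of `u`, as a subset of `X × [0,1]`, which carries the metric
`d((x, s), (y, t)) = d(x, y) + |s - t|` (the `L¹` product of the two metric spaces). -/
def endograph {X : Type*} (u : FuzzySet X) : Set (WithLp 1 (X × unitInterval)) :=
  {z | z.snd ≤ u z.fst}

/-- The set `F¹_USCG(X)` of the fuzzy sets all of whose `α`-cuts, `α ∈ (0,1]`, are nonempty and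
compact. -/
def F1USCG (X : Type*) [MetricSpace X] : Set (FuzzySet X) :=
  {u | ∀ α ∈ Set.Ioc (0 : ℝ) 1, (cut u α).Nonempty ∧ IsCompact (cut u α)}

/-- The endograph metric: the Hausdorff distance of the endographs. -/
noncomputable def Hend {X : Type*} [MetricSpace X] (u v : FuzzySet X) : ℝ≥0∞ :=
  Metric.hausdorffEDist (endograph u) (endograph v)

/-- The `d_p` distance `(∫₀¹ H([u]_α, [v]_α)^p dα)^(1/p)`, which may be infinite. It is used for
`u` and `v` in `F¹_USCG(X)`, where the integrand is measurable. -/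
noncomputable def dp {X : Type*} [MetricSpace X] (p : ℝ) (u v : FuzzySet X) : ℝ≥0∞ :=
  (∫⁻ α in Set.Icc (0 : ℝ) 1, Metric.hausdorffEDist (cut u α) (cut v α) ^ p) ^ (1 / p)

/-- The set `F¹_USCG(X)^p` of the `u ∈ F¹_USCG(X)` at finite `d_p` distance from the fuzzy set
`χ_{x₀}` for some point `x₀` of `X` (equivalently, for every point). -/
def F1USCGp (X : Type*) [MetricSpace X] (p : ℝ) : Set (FuzzySet X) :=
  {u | u ∈ F1USCG X ∧ ∃ x₀ : X, dp p u (crisp {x₀}) < ⊤}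

/-- The inclusion of `F¹_USCG(X)^p` in `F¹_USCG(X)`. -/
def toF1USCG {X : Type*} [MetricSpace X] {p : ℝ} (u : F1USCGp X p) : F1USCG X :=
  ⟨u.1, u.2.1⟩

/-- The topology induced by an extended metric `ρ` on `Y`: a set is open if with each of its points
it contains a `ρ`-ball of positive radius about that point. -/
@[reducible] def distTopology {Y : Type*} (ρ : Y → Y → ℝ≥0∞) : TopologicalSpace Y where
  IsOpen s := ∀ x ∈ s, ∃ ε > 0, ∀ y, ρ x y < ε → y ∈ s
  isOpen_univ := fun _ _ => ⟨1, one_pos, fun _ _ => trivial⟩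
  isOpen_inter := by
    intro s t hs ht x hx
    obtain ⟨a, ha, hsa⟩ := hs x hx.1
    obtain ⟨b, hb, htb⟩ := ht x hx.2
    exact ⟨min a b, lt_min ha hb, fun y hy =>
      ⟨hsa y (hy.trans_le (min_le_left a b)), htb y (hy.trans_le (min_le_right a b))⟩⟩
  isOpen_sUnion := by
    intro S hS x hx
    obtain ⟨t, htS, hxt⟩ := hx
    obtain ⟨a, ha, hta⟩ := hS t htS x hxt
    exact ⟨a, ha, fun y hy => ⟨t, htS, hta y hy⟩⟩

/-- The topology of `(F¹_USCG(X), H_end)`. -/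
noncomputable instance instTopologicalSpaceF1USCG (X : Type*) [MetricSpace X] :
    TopologicalSpace (F1USCG X) :=
  distTopology fun u v => Hend u.1 v.1

/-- The topology of `(F¹_USCG(X)^p, d_p)`. -/
noncomputable instance instTopologicalSpaceF1USCGp (X : Type*) [MetricSpace X] (p : ℝ) :
    TopologicalSpace (F1USCGp X p) :=
  distTopology fun u v => dp p u.1 v.1

/-- `U` is `p`-mean equi-left-continuous. -/
def PMeanEquiLeftContinuous {X : Type*} [MetricSpace X] {p : ℝ} (U : Set (F1USCGp X p)) : Prop :=
  ∀ ε : ℝ, 0 < ε → ∃ δ ∈ Set.Ioc (0 : ℝ) 1, ∀ h : ℝ, 0 ≤ h → h < δ → ∀ u ∈ U,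
    (∫⁻ α in Set.Icc h 1, Metric.hausdorffEDist (cut u.1 α) (cut u.1 (α - h)) ^ p) ^ (1 / p)
      < ENNReal.ofReal ε

/-- `U(α)`, the union of the `α`-cuts of the members of `U`. -/
def cutUnion {X : Type*} [MetricSpace X] {p : ℝ} (U : Set (F1USCGp X p)) (α : ℝ) : Set X :=
  ⋃ u ∈ U, cut u.1 α

end FuzzySpace

/-! The four conditions are proved equivalent in the cycle 1 → 2 → 4 → 3 → 1.

From 1 to 2: `d_p`-closeness forces closeness of endographs (`continuous_toF1USCG`, a Chebyshev
argument on a short band of levels), and equi-left-continuity passes from a finite net to a totally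
bounded set, since each single member is `p`-mean left-continuous (`tendsto_shiftNorm`).

From 2 to 4: points of the level sets, lifted to height `α`, accumulate on the closed endograph of a
limit (`isCompact_cutUnion`), and `U` is the preimage of a compact set in a Hausdorff space under a
continuous injection.

From 3 to 1, the main step: compactness of the hyperspace at all rational levels gives a subsequence
whose cuts converge there. The limits define a fuzzy set, which has only countably many jumps, so
the cuts converge at almost every level (`exists_subseq_ae_tendsto_cut`). On `[h,1]` dominated
convergence applies. The levels near `0`, where there is no common bound, are reached by shifting
levels by `h`, at a cost that equi-left-continuity makes uniformly small and that Fatou's lemma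
carries over to the limit (`dp_le_shiftNorm_add`, `shiftNorm_le_of_ae_tendsto`). -/

open scoped Topology
open Set Filter MeasureTheory Metric

namespace FuzzySpace

/-! ### Hausdorff distance of nested and converging sets -/

section Hausdorff

variable {X : Type*} [PseudoEMetricSpace X] {A A' B B' C C' : Set X}

theorem hausdorffEDist_le_of_subset {r : ℝ≥0∞} (h : A ⊆ B) (H : ∀ x ∈ B, infEDist x A ≤ r) :
    hausdorffEDist A B ≤ r :=
  hausdorffEDist_le_of_infEDist (fun x hx => by simp [infEDist_zero_of_mem (h hx)]) H

theorem hausdorffEDist_le_of_nested (h₁ : A ⊆ A') (h₂ : A' ⊆ B') (h₃ : B' ⊆ B) :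
    hausdorffEDist A' B' ≤ hausdorffEDist A B :=
  hausdorffEDist_le_of_subset h₂ fun x hx => (infEDist_anti h₁).trans (by
    rw [hausdorffEDist_comm]; exact infEDist_le_hausdorffEDist_of_mem (h₃ hx))

/-- Each middle set can be replaced by an outer one of its own chain. Hence convergence at two
bracketing levels controls the level between them, up to the gap of the limit. -/
theorem hausdorffEDist_le_of_sandwich (hAB : A ⊆ B) (hBC : B ⊆ C) (hAB' : A' ⊆ B')
    (hBC' : B' ⊆ C') :
    hausdorffEDist B B' ≤
      hausdorffEDist A C + (hausdorffEDist A A' + hausdorffEDist C C') := by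
  refine hausdorffEDist_le_of_infEDist (fun x hx => ?_) (fun x hx => ?_)
  · calc infEDist x B' ≤ infEDist x A' := infEDist_anti hAB'
      _ ≤ infEDist x A + hausdorffEDist A A' := infEDist_le_infEDist_add_hausdorffEDist
      _ ≤ hausdorffEDist A C + (hausdorffEDist A A' + hausdorffEDist C C') := by
        rw [← add_assoc, hausdorffEDist_comm (s := A) (t := C)]
        exact (add_le_add_left (infEDist_le_hausdorffEDist_of_mem (hBC hx)) _).trans
          le_self_add
  · calc infEDist x B ≤ infEDist x A := infEDist_anti hAB
      _ ≤ infEDist x C + hausdorffEDist C A := infEDist_le_infEDist_add_hausdorffEDist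
      _ ≤ hausdorffEDist A C + (hausdorffEDist A A' + hausdorffEDist C C') := by
        rw [add_comm, hausdorffEDist_comm (s := A) (t := C), hausdorffEDist_comm (s := C) (t := C')]
        gcongr
        exact (infEDist_le_hausdorffEDist_of_mem (hBC' hx)).trans le_add_self

theorem tendsto_hausdorffEDist {ι : Type*} {l : Filter ι} {S T : ι → Set X} {S₀ T₀ : Set X}
    (hS : Tendsto (fun i => hausdorffEDist (S i) S₀) l (𝓝 0))
    (hT : Tendsto (fun i => hausdorffEDist (T i) T₀) l (𝓝 0)) :
    Tendsto (fun i => hausdorffEDist (S i) (T i)) l (𝓝 (hausdorffEDist S₀ T₀)) := by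
  have hsum := hS.add hT
  rw [add_zero] at hsum
  -- Squeeze between truncated difference and sum, which needs no finiteness of the limiting
  -- distance.
  have h₁ : Tendsto (fun i => hausdorffEDist S₀ T₀ -
      (hausdorffEDist (S i) S₀ + hausdorffEDist (T i) T₀)) l (𝓝 (hausdorffEDist S₀ T₀)) := by
    simpa using ENNReal.Tendsto.sub (tendsto_const_nhds (x := hausdorffEDist S₀ T₀)) hsum
      (Or.inr ENNReal.zero_ne_top)
  have h₂ : Tendsto (fun i => hausdorffEDist S₀ T₀ +
      (hausdorffEDist (S i) S₀ + hausdorffEDist (T i) T₀)) l (𝓝 (hausdorffEDist S₀ T₀)) := by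
    simpa using (tendsto_const_nhds (x := hausdorffEDist S₀ T₀)).add hsum
  refine tendsto_of_tendsto_of_tendsto_of_le_of_le h₁ h₂ (fun i => ?_) (fun i => ?_)
  · rw [tsub_le_iff_right]
    calc hausdorffEDist S₀ T₀ ≤ hausdorffEDist S₀ (S i) + hausdorffEDist (S i) T₀ :=
          hausdorffEDist_triangle
      _ ≤ hausdorffEDist S₀ (S i) + (hausdorffEDist (S i) (T i) + hausdorffEDist (T i) T₀) := by
          gcongr; exact hausdorffEDist_triangle
      _ = _ := by rw [hausdorffEDist_comm (s := S₀)]; ring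
  · calc hausdorffEDist (S i) (T i) ≤ hausdorffEDist (S i) S₀ + hausdorffEDist S₀ (T i) :=
          hausdorffEDist_triangle
      _ ≤ hausdorffEDist (S i) S₀ + (hausdorffEDist S₀ T₀ + hausdorffEDist T₀ (T i)) := by
          gcongr; exact hausdorffEDist_triangle
      _ = _ := by rw [hausdorffEDist_comm (s := T₀)]; ring

end Hausdorff

theorem hausdorffEDist_ne_top_of_isCompact {X : Type*} [MetricSpace X] {A B : Set X}
    (hA : A.Nonempty) (hA' : IsCompact A) (hB : B.Nonempty) (hB' : IsCompact B) :
    hausdorffEDist A B ≠ ∞ :=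
  hausdorffEDist_ne_top_of_nonempty_of_bounded hA hB hA'.isBounded hB'.isBounded

/-- A left-continuous function is the pointwise limit of its values at the largest multiple of
`1/(n+1)` strictly below `α`. These approximants factor through `ℤ`, so they are measurable whatever
`f` is. -/
theorem aemeasurable_of_tendsto_left {f : ℝ → ℝ≥0∞} {a b : ℝ}
    (hf : ∀ α ∈ Ioc a b, Tendsto f (𝓝[<] α) (𝓝 (f α))) :
    AEMeasurable f (volume.restrict (Icc a b)) := by
  -- The left endpoint is dropped: in the applications it can be level `0`, where the cut is a
  -- support and need not be compact.
  rw [← Measure.restrict_congr_set Ioc_ae_eq_Icc]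
  refine aemeasurable_of_tendsto_metrizable_ae atTop
    (f := fun (n : ℕ) α => f (((⌈((n : ℝ) + 1) * α⌉ : ℝ) - 1) / (n + 1))) (fun n => ?_) ?_
  · have h₁ : Measurable fun α : ℝ => ⌈((n : ℝ) + 1) * α⌉ :=
      Int.measurable_ceil.comp (measurable_const_mul _)
    have h₂ : Measurable fun k : ℤ => f (((k : ℝ) - 1) / (n + 1)) := measurable_of_countable _
    exact (h₂.comp h₁).aemeasurable
  · refine (ae_restrict_iff' measurableSet_Ioc).2 (Eventually.of_forall fun α hα => ?_)
    refine (hf α hα).comp (tendsto_nhdsWithin_iff.2 ⟨?_, Eventually.of_forall fun n => ?_⟩)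
    · have h₀ : Tendsto (fun n : ℕ => α - 1 / ((n : ℝ) + 1)) atTop (𝓝 α) := by
        simpa using (tendsto_const_nhds (x := α)).sub
          (tendsto_one_div_add_atTop_nhds_zero_nat (𝕜 := ℝ))
      refine tendsto_of_tendsto_of_tendsto_of_le_of_le h₀ tendsto_const_nhds (fun n => ?_)
        (fun n => ?_)
      · have hn : (0 : ℝ) < n + 1 := by positivity
        have := Int.le_ceil (((n : ℝ) + 1) * α)
        simp only
        rw [le_div_iff₀ hn, sub_mul, one_div_mul_cancel hn.ne']
        linarith
      · have hn : (0 : ℝ) < n + 1 := by positivity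
        have := Int.ceil_lt_add_one (((n : ℝ) + 1) * α)
        simp only
        rw [div_le_iff₀ hn]
        linarith
    · have hn : (0 : ℝ) < n + 1 := by positivity
      have := Int.ceil_lt_add_one (((n : ℝ) + 1) * α)
      rw [mem_Iio, div_lt_iff₀ hn]
      linarith

/-! ### Left-continuity and jumps of the cuts -/

section Cuts

variable {X : Type*}

theorem cut_of_pos [TopologicalSpace X] (u : FuzzySet X) {α : ℝ} (hα : 0 < α) :
    cut u α = {x | α ≤ (u x : ℝ)} := by
  simp [cut, hα.ne']

theorem cut_anti [TopologicalSpace X] (u : FuzzySet X) {α β : ℝ} (hα : 0 < α) (h : α ≤ β) :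
    cut u β ⊆ cut u α := by
  rw [cut_of_pos u hα, cut_of_pos u (hα.trans_le h)]
  exact fun x hx => h.trans hx

variable [MetricSpace X]

theorem hausdorffEDist_cut_ne_top {u v : FuzzySet X} (hu : u ∈ F1USCG X) (hv : v ∈ F1USCG X)
    {α β : ℝ} (hα : α ∈ Ioc (0 : ℝ) 1) (hβ : β ∈ Ioc (0 : ℝ) 1) :
    hausdorffEDist (cut u α) (cut v β) ≠ ∞ :=
  hausdorffEDist_ne_top_of_isCompact (hu α hα).1 (hu α hα).2 (hv β hβ).1 (hv β hβ).2

/-- The cuts of a fuzzy set in `F1USCG X` depend left-continuously on the level. -/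
theorem tendsto_cut_left {u : FuzzySet X} (hu : u ∈ F1USCG X) {α : ℝ} (hα : α ∈ Ioc (0 : ℝ) 1) :
    Tendsto (fun β => hausdorffEDist (cut u β) (cut u α)) (𝓝[≤] α) (𝓝 0) := by
  rw [ENNReal.tendsto_nhds_zero]
  intro ε hε
  have hne : Nonempty (Ioo 0 α) := ⟨⟨α / 2, by constructor <;> linarith [hα.1]⟩⟩
  -- The cut at `α` is the intersection of the lower cuts, a directed family of compact sets, so one
  -- of them already lies in the open `ε`-thickening.
  obtain ⟨⟨β, hβ⟩, hsub⟩ : ∃ β : Ioo 0 α, cut u β ⊆ {x | infEDist x (cut u α) < ε} := by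
    refine exists_subset_nhds_of_isCompact (V := fun β : Ioo 0 α => cut u β) ?_ ?_ ?_
    · intro β γ
      rcases le_total β.1 γ.1 with h | h
      · exact ⟨γ, cut_anti u β.2.1 h, subset_rfl⟩
      · exact ⟨β, subset_rfl, cut_anti u γ.2.1 h⟩
    · exact fun β => (hu β ⟨β.2.1, β.2.2.le.trans hα.2⟩).2
    · intro x hx
      refine (isOpen_lt continuous_infEDist continuous_const).mem_nhds ?_
      have hxα : x ∈ cut u α := by
        rw [cut_of_pos u hα.1]
        change α ≤ (u x : ℝ)
        refine le_of_forall_lt fun β hβ => ?_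
        obtain ⟨γ, hγ, hγα⟩ := exists_between (max_lt hβ hα.1)
        have hγ0 := (le_max_right _ _).trans_lt hγ
        have := mem_iInter.1 hx ⟨γ, hγ0, hγα⟩
        rw [cut_of_pos u hγ0] at this
        exact ((le_max_left _ _).trans_lt hγ).trans_le this
      simpa [infEDist_zero_of_mem hxα] using hε
  filter_upwards [Ioc_mem_nhdsLE hβ.2] with γ hγ
  rw [hausdorffEDist_comm]
  have hγ0 := hβ.1.trans hγ.1
  exact hausdorffEDist_le_of_subset (cut_anti u hγ0 hγ.2) fun x hx =>
    (hsub (cut_anti u hβ.1 hγ.1.le hx)).le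

theorem aemeasurable_hausdorffEDist_cut {u v : FuzzySet X} (hu : u ∈ F1USCG X)
    (hv : v ∈ F1USCG X) {a b : ℝ} (ha : 0 ≤ a) (hb : b ≤ 1) :
    AEMeasurable (fun α => hausdorffEDist (cut u α) (cut v α)) (volume.restrict (Icc a b)) :=
  aemeasurable_of_tendsto_left fun α hα => by
    have hα' : α ∈ Ioc (0 : ℝ) 1 := ⟨ha.trans_lt hα.1, hα.2.trans hb⟩
    exact (tendsto_hausdorffEDist (tendsto_cut_left hu hα') (tendsto_cut_left hv hα')).mono_left
      (nhdsWithin_mono _ Iio_subset_Iic_self)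

theorem tendsto_sub_nhdsLE (h α : ℝ) : Tendsto (fun β => β - h) (𝓝[≤] α) (𝓝[≤] (α - h)) :=
  tendsto_nhdsWithin_iff.2 ⟨((continuous_id.sub continuous_const).tendsto α).mono_left
    nhdsWithin_le_nhds, eventually_mem_nhdsWithin.mono fun _ hβ => sub_le_sub_right hβ h⟩

theorem aemeasurable_hausdorffEDist_cut_sub {u : FuzzySet X} (hu : u ∈ F1USCG X) {a b h : ℝ}
    (hh : 0 ≤ h) (ha : h ≤ a) (hb : b ≤ 1) :
    AEMeasurable (fun α => hausdorffEDist (cut u α) (cut u (α - h)))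
      (volume.restrict (Icc a b)) :=
  aemeasurable_of_tendsto_left fun α hα => by
    have hα' : α ∈ Ioc (0 : ℝ) 1 := ⟨(hh.trans ha).trans_lt hα.1, hα.2.trans hb⟩
    have hαh : α - h ∈ Ioc (0 : ℝ) 1 := ⟨by linarith [hα.1], by linarith [hα.2]⟩
    exact (tendsto_hausdorffEDist (tendsto_cut_left hu hα')
      ((tendsto_cut_left hu hαh).comp (tendsto_sub_nhdsLE h α))).mono_left
      (nhdsWithin_mono _ Iio_subset_Iic_self)

/-- A jump of size `ε` at `α` produces a point of that cut at distance at least `ε / 2` from every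
higher cut. Such points at different levels are `ε / 2`-separated inside the compact cut at `η`, so
there are finitely many. -/
theorem finite_jumps_cut {u : FuzzySet X} (hu : u ∈ F1USCG X) {η : ℝ} (hη : η ∈ Ioc (0 : ℝ) 1)
    {ε : ℝ≥0∞} (hε : ε ≠ 0) :
    {α | α ∈ Ico η 1 ∧ ∀ γ ∈ Ioc α 1, ε ≤ hausdorffEDist (cut u γ) (cut u α)}.Finite := by
  set D := {α | α ∈ Ico η 1 ∧ ∀ γ ∈ Ioc α 1, ε ≤ hausdorffEDist (cut u γ) (cut u α)}
  have hpt : ∀ α ∈ D, ∃ x ∈ cut u α, ∀ γ ∈ Ioc α 1, ∀ y ∈ cut u γ, ε / 2 ≤ edist x y := by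
    rintro α ⟨hα, hjump⟩
    have hα0 : 0 < α := hη.1.trans_le hα.1
    -- Otherwise the open thickenings of the higher cuts cover the compact cut at `α`; being
    -- directed, a single one covers it, and the jump is at most `ε / 2`.
    by_contra! hcon
    have hne : Nonempty (Ioc α 1) := ⟨⟨1, hα.2, le_rfl⟩⟩
    obtain ⟨⟨γ, hγ⟩, hsub⟩ := (hu α ⟨hα0, hα.2.le⟩).2.elim_directed_cover
      (fun γ : Ioc α 1 => {x | infEDist x (cut u γ) < ε / 2})
      (fun γ => isOpen_lt continuous_infEDist continuous_const)
      (fun x hx => by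
        obtain ⟨γ, hγ, y, hy, hxy⟩ := hcon x hx
        exact mem_iUnion.2 ⟨⟨γ, hγ⟩, (infEDist_le_edist_of_mem hy).trans_lt hxy⟩)
      (by
        intro γ γ'
        rcases le_total γ.1 γ'.1 with h | h
        · exact ⟨γ, subset_rfl, fun x hx =>
            (infEDist_anti (cut_anti u (hα0.trans γ.2.1) h)).trans_lt hx⟩
        · exact ⟨γ', fun x hx =>
            (infEDist_anti (cut_anti u (hα0.trans γ'.2.1) h)).trans_lt hx, subset_rfl⟩)
    have h₁ : hausdorffEDist (cut u γ) (cut u α) ≤ ε / 2 :=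
      hausdorffEDist_le_of_subset (cut_anti u hα0 hγ.1.le) fun x hx => (hsub hx).le
    have h₂ := (hjump γ hγ).trans h₁
    have h₃ : ε ≠ ∞ := fun h => hausdorffEDist_cut_ne_top hu hu
      (α := γ) (β := α) ⟨hα0.trans hγ.1, hγ.2⟩ ⟨hα0, hα.2.le⟩ (top_le_iff.1 (h ▸ hjump γ hγ))
    exact (ENNReal.half_lt_self hε h₃).not_ge h₂
  have : Nonempty X := ⟨(hu η hη).1.some⟩
  choose! x hx hsep using hpt
  obtain ⟨t, ht, hcov⟩ := EMetric.totallyBounded_iff.1 (hu η hη).2.totallyBounded (ε / 2 / 2)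
    (ENNReal.half_pos (ENNReal.half_pos hε).ne')
  refine (ht.biUnion (t := fun y => {α | α ∈ D ∧ x α ∈ eball y (ε / 2 / 2)}) fun y _ => ?_).subset
    fun α hα => ?_
  · have hlt : ∀ α β, α ∈ D → β ∈ D → x α ∈ eball y (ε / 2 / 2) → x β ∈ eball y (ε / 2 / 2) →
        ¬ α < β := by
      intro α β hα hβ hαy hβy hlt
      have h₁ := hsep α hα β ⟨hlt, hβ.1.2.le⟩ (x β) (hx β hβ)
      refine h₁.not_gt ((edist_triangle_right _ _ y).trans_lt ?_)
      calc _ < ε / 2 / 2 + ε / 2 / 2 := ENNReal.add_lt_add hαy hβy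
        _ = ε / 2 := ENNReal.add_halves _
    refine Set.Subsingleton.finite fun α hα β hβ => le_antisymm ?_ ?_
    · exact not_lt.1 (hlt β α hβ.1 hα.1 hβ.2 hα.2)
    · exact not_lt.1 (hlt α β hα.1 hβ.1 hα.2 hβ.2)
  · obtain ⟨y, hy, hxy⟩ := mem_iUnion₂.1 (hcov (cut_anti u hη.1 hα.1.1 (hx α hα)))
    exact mem_iUnion₂.2 ⟨y, hy, hα, hxy⟩

/-- Outside a null set of levels the cuts of a fuzzy set in `F1USCG X` do not jump. -/
theorem ae_exists_hausdorffEDist_cut_lt {u : FuzzySet X} (hu : u ∈ F1USCG X) :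
    ∀ᵐ α ∂(volume.restrict (Icc (0 : ℝ) 1)), α ∈ Ioo (0 : ℝ) 1 ∧ ∀ ε : ℝ≥0∞, 0 < ε →
      ∃ β ∈ Ioo 0 α, ∃ γ ∈ Ioc α 1, hausdorffEDist (cut u γ) (cut u β) < ε := by
  rw [← Measure.restrict_congr_set Ioo_ae_eq_Icc, ae_restrict_iff' measurableSet_Ioo]
  have hc : (⋃ (n : ℕ) (m : ℕ), {α | α ∈ Ico (1 / ((n : ℝ) + 1)) 1 ∧
      ∀ γ ∈ Ioc α 1, ((m : ℝ≥0∞) + 1)⁻¹ ≤ hausdorffEDist (cut u γ) (cut u α)}).Countable := by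
    refine countable_iUnion fun n => countable_iUnion fun m =>
      (finite_jumps_cut hu ⟨by positivity, ?_⟩ ?_).countable
    · rw [div_le_one (by positivity)]; linarith [Nat.cast_nonneg (α := ℝ) n]
    · simp
  filter_upwards [hc.ae_notMem volume] with α hbad hα
  refine ⟨hα, fun ε hε => ?_⟩
  obtain ⟨m, hm⟩ := ENNReal.exists_inv_nat_lt (ENNReal.half_pos hε.ne').ne'
  obtain ⟨n, hn⟩ := exists_nat_one_div_lt hα.1
  obtain ⟨γ, hγ, hlt⟩ : ∃ γ ∈ Ioc α 1,
      hausdorffEDist (cut u γ) (cut u α) < ((m : ℝ≥0∞) + 1)⁻¹ := by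
    by_contra! h
    exact hbad (mem_iUnion₂.2 ⟨n, m, ⟨hn.le, hα.2⟩, h⟩)
  -- Left-continuity holds at every level, so only jumps from the right had to be excluded.
  have hleft := (ENNReal.tendsto_nhds_zero.1
    ((tendsto_cut_left hu ⟨hα.1, hα.2.le⟩).mono_left (nhdsWithin_mono _ Iio_subset_Iic_self))
    (ε / 2) (ENNReal.half_pos hε.ne')).and (Ioo_mem_nhdsLT hα.1)
  obtain ⟨β, hβ, hβα⟩ := hleft.exists
  refine ⟨β, hβα, γ, hγ, ?_⟩
  calc hausdorffEDist (cut u γ) (cut u β)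
      ≤ hausdorffEDist (cut u γ) (cut u α) + hausdorffEDist (cut u β) (cut u α) := by
        rw [hausdorffEDist_comm (s := cut u β)]; exact hausdorffEDist_triangle
    _ < ε / 2 + ε / 2 := by
        refine ENNReal.add_lt_add_of_lt_of_le (hausdorffEDist_cut_ne_top hu hu
          ⟨hβα.1, (hβα.2.trans hα.2).le⟩ ⟨hα.1, hα.2.le⟩) (hlt.trans_le (le_trans ?_ hm.le)) hβ
        exact ENNReal.inv_le_inv.2 le_self_add
    _ = ε := ENNReal.add_halves ε

end Cuts

/-! ### Extended pseudometrics inducing the given topologies -/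

section DistTopology

variable {Y : Type*} (ρ : Y → Y → ℝ≥0∞) (h₀ : ∀ x, ρ x x = 0) (hc : ∀ x y, ρ x y = ρ y x)
  (ht : ∀ x y z, ρ x z ≤ ρ x y + ρ y z)

/-- The extended pseudometric structure with distance `ρ`, whose topology is, by definition,
`distTopology ρ`. -/
@[reducible] noncomputable def distPseudoEMetricSpace : PseudoEMetricSpace Y :=
  let m : PseudoEMetricSpace Y :=
    { edist := ρ, edist_self := h₀, edist_comm := hc, edist_triangle := ht }
  { edist := ρ
    edist_self := h₀
    edist_comm := hc
    edist_triangle := ht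
    toUniformSpace := @UniformSpace.replaceTopology Y (distTopology ρ) m.toUniformSpace (by
      ext s
      rw [@EMetric.isOpen_iff Y m]
      simp only [subset_def, mem_eball]
      refine forall₂_congr fun x _ => exists_congr fun ε => and_congr_right fun _ =>
        forall_congr' fun y => ?_
      rw [hc x y]
      rfl)
    uniformity_edist := m.uniformity_edist }

end DistTopology

/-! ### Minkowski-type estimates over sets of levels -/

section LevelNorm

/-- The `L^p` norm of a `[0,∞]`-valued function on a set of levels. -/
noncomputable def levelNorm (p : ℝ) (s : Set ℝ) (f : ℝ → ℝ≥0∞) : ℝ≥0∞ :=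
  (∫⁻ α in s, f α ^ p) ^ (1 / p)

variable {p : ℝ} {s t : Set ℝ} {f g k : ℝ → ℝ≥0∞}

theorem levelNorm_mono (hp : 0 ≤ p) (hs : MeasurableSet s) (h : ∀ α ∈ s, f α ≤ g α) :
    levelNorm p s f ≤ levelNorm p s g := by
  have := setLIntegral_mono' (μ := volume) hs fun α hα => ENNReal.rpow_le_rpow (h α hα) hp
  exact ENNReal.rpow_le_rpow this (by positivity)

theorem levelNorm_mono_set (hp : 0 ≤ p) (h : s ⊆ t) : levelNorm p s f ≤ levelNorm p t f :=
  ENNReal.rpow_le_rpow (lintegral_mono_set h) (by positivity)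

theorem levelNorm_le_add (hp : 1 ≤ p) (hs : MeasurableSet s)
    (hg : AEMeasurable g (volume.restrict s)) (hk : AEMeasurable k (volume.restrict s))
    (h : ∀ α ∈ s, f α ≤ g α + k α) : levelNorm p s f ≤ levelNorm p s g + levelNorm p s k :=
  (levelNorm_mono (g := g + k) (by linarith) hs h).trans (ENNReal.lintegral_Lp_add_le hg hk hp)

theorem levelNorm_le_iff (hp : 0 < p) {ε : ℝ≥0∞} :
    levelNorm p s f ≤ ε ↔ ∫⁻ α in s, f α ^ p ≤ ε ^ p := by
  rw [levelNorm, one_div, ENNReal.rpow_inv_le_iff hp]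

end LevelNorm

/-! ### Comparison of `d_p` with the endograph metric -/

section Metrics

theorem le_of_endograph_subset {X : Type*} {u v : FuzzySet X} (h : endograph u ⊆ endograph v)
    (x : X) : u x ≤ v x :=
  h (show WithLp.toLp 1 (x, u x) ∈ endograph u from le_refl (u x))

variable {X : Type*} [MetricSpace X]

theorem dp_self {p : ℝ} (hp : 1 ≤ p) (u : FuzzySet X) : dp p u u = 0 := by
  have : 0 < p := by linarith
  simp [dp, ENNReal.zero_rpow_of_pos, this]

theorem dp_comm (p : ℝ) (u v : FuzzySet X) : dp p u v = dp p v u := by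
  simp only [dp, hausdorffEDist_comm]

theorem dp_triangle {p : ℝ} (hp : 1 ≤ p) {u v w : FuzzySet X} (hu : u ∈ F1USCG X)
    (hv : v ∈ F1USCG X) (hw : w ∈ F1USCG X) : dp p u w ≤ dp p u v + dp p v w :=
  levelNorm_le_add hp measurableSet_Icc (aemeasurable_hausdorffEDist_cut hu hv le_rfl le_rfl)
    (aemeasurable_hausdorffEDist_cut hv hw le_rfl le_rfl) fun _ _ => hausdorffEDist_triangle

noncomputable instance (p : ℝ) [hp : Fact (1 ≤ p)] : PseudoEMetricSpace (F1USCGp X p) :=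
  distPseudoEMetricSpace (fun u v => dp p u.1 v.1) (fun u => dp_self hp.out u.1)
    (fun u v => dp_comm p u.1 v.1)
    (fun u v w => dp_triangle hp.out u.2.1 v.2.1 w.2.1)

noncomputable instance : PseudoEMetricSpace (F1USCG X) :=
  distPseudoEMetricSpace (fun u v => Hend u.1 v.1) (fun _ => hausdorffEDist_self)
    (fun _ _ => hausdorffEDist_comm) (fun _ _ _ => hausdorffEDist_triangle)

theorem edist_F1USCGp {p : ℝ} [Fact (1 ≤ p)] (u v : F1USCGp X p) : edist u v = dp p u.1 v.1 := rfl

theorem edist_withLp_one {Z W : Type*} [PseudoEMetricSpace Z] [PseudoEMetricSpace W]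
    (z w : WithLp 1 (Z × W)) : edist z w = edist z.fst w.fst + edist z.snd w.snd := by
  rw [WithLp.prod_edist_eq_add (by simp)]
  simp

theorem isClosed_endograph {u : FuzzySet X} (hu : u ∈ F1USCG X) : IsClosed (endograph u) := by
  let f : X → unitInterval := u
  have husc : UpperSemicontinuous f := by
    refine upperSemicontinuous_iff_isClosed_preimage.2 fun t => ?_
    rcases eq_or_lt_of_le t.2.1 with h | h
    · have ht : t = 0 := Subtype.ext h.symm
      have : f ⁻¹' Ici t = univ := eq_univ_of_forall fun x => by
        rw [ht]; exact unitInterval.nonneg'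
      rw [this]; exact isClosed_univ
    · have : f ⁻¹' Ici t = cut u t := by rw [cut_of_pos u h]; rfl
      rw [this]; exact (hu t ⟨h, t.2.2⟩).2.isClosed
  have hc : Continuous fun z : WithLp 1 (X × unitInterval) => (z.fst, z.snd) :=
    WithLp.prod_continuous_ofLp 1 X unitInterval
  exact (upperSemicontinuous_iff_IsClosed_hypograph.1 husc).preimage hc

instance : T0Space (F1USCG X) where
  t0 u v h := by
    have h₀ : hausdorffEDist (endograph u.1) (endograph v.1) = 0 := EMetric.inseparable_iff.1 h
    rw [(isClosed_endograph u.2).hausdorffEDist_zero_iff (isClosed_endograph v.2)] at h₀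
    exact Subtype.ext (funext fun x => le_antisymm (le_of_endograph_subset h₀.subset x)
      (le_of_endograph_subset h₀.superset x))

theorem toF1USCG_injective {p : ℝ} : Function.Injective (toF1USCG : F1USCGp X p → F1USCG X) :=
  fun _ _ h => Subtype.ext (congrArg (fun w : F1USCG X => w.1) h)

/-- Chebyshev: if the cuts were at least `r` apart on all of `(a, b)`, the integral would be at
least `r ^ p * (b - a)`. -/
theorem exists_hausdorffEDist_cut_lt {p : ℝ} (hp : 0 < p) {u v : FuzzySet X} {a b : ℝ}
    (ha : 0 ≤ a) (hb : b ≤ 1) {r : ℝ≥0∞}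
    (h : dp p u v < (r ^ p * ENNReal.ofReal (b - a)) ^ (1 / p)) :
    ∃ γ ∈ Ioo a b, hausdorffEDist (cut u γ) (cut v γ) < r := by
  by_contra! hcon
  refine h.not_ge (ENNReal.rpow_le_rpow ?_ (by positivity))
  calc r ^ p * ENNReal.ofReal (b - a) = ∫⁻ _ in Ioo a b, r ^ p := by simp
    _ ≤ ∫⁻ α in Ioo a b, hausdorffEDist (cut u α) (cut v α) ^ p :=
      setLIntegral_mono' measurableSet_Ioo fun α hα => ENNReal.rpow_le_rpow (hcon α hα) hp.le
    _ ≤ _ := lintegral_mono_set (Ioo_subset_Icc_self.trans (Icc_subset_Icc ha hb))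

/-- A point of height at most `ε` is dropped to height `0`, which belongs to every endograph. A
higher point is moved down by less than `ε`, to a level where the cuts are `ε`-close, and then
sideways. -/
theorem infEDist_endograph_le {p : ℝ} (hp : 0 < p) {u v : FuzzySet X} {ε : ℝ}
    (hε : 0 < ε)
    (h : dp p u v < (ENNReal.ofReal ε ^ p * ENNReal.ofReal ε) ^ (1 / p))
    {z : WithLp 1 (X × unitInterval)} (hz : z ∈ endograph u) :
    infEDist z (endograph v) ≤ ENNReal.ofReal (2 * ε) := by
  rcases le_or_gt (z.snd : ℝ) ε with hle | hlt
  · refine (infEDist_le_edist_of_mem (y := WithLp.toLp 1 (z.fst, 0))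
      (show (0 : unitInterval) ≤ _ from unitInterval.nonneg')).trans ?_
    rw [edist_withLp_one, Subtype.edist_eq, edist_dist (z.snd : ℝ), Real.dist_eq]
    change edist z.fst z.fst + _ ≤ _
    rw [edist_self, zero_add]
    refine ENNReal.ofReal_le_ofReal ?_
    change |(z.snd : ℝ) - 0| ≤ _
    rw [sub_zero, abs_of_nonneg z.snd.2.1]
    linarith
  · obtain ⟨γ, hγ, hH⟩ := exists_hausdorffEDist_cut_lt hp (u := u) (v := v)
      (a := (z.snd : ℝ) - ε) (b := z.snd) (r := ENNReal.ofReal ε) (by linarith) z.snd.2.2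
      (by rwa [sub_sub_cancel])
    have hγ0 : 0 < γ := by linarith [hγ.1]
    have hx : z.fst ∈ cut u γ := by
      rw [cut_of_pos u hγ0]
      exact hγ.2.le.trans (Subtype.coe_le_coe.2 hz)
    obtain ⟨y, hy, hxy⟩ := exists_edist_lt_of_hausdorffEDist_lt hx hH
    rw [cut_of_pos v hγ0] at hy
    refine (infEDist_le_edist_of_mem (y := WithLp.toLp 1
      (y, ⟨γ, hγ0.le, hγ.2.le.trans z.snd.2.2⟩)) (show _ ≤ v y from hy)).trans ?_
    rw [edist_withLp_one, Subtype.edist_eq, edist_dist (z.snd : ℝ), Real.dist_eq, two_mul,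
      ENNReal.ofReal_add hε.le hε.le]
    refine add_le_add hxy.le (ENNReal.ofReal_le_ofReal ?_)
    change |(z.snd : ℝ) - γ| ≤ ε
    rw [abs_of_pos (by linarith [hγ.2])]
    linarith [hγ.1]

theorem continuous_toF1USCG {p : ℝ} [hp : Fact (1 ≤ p)] :
    Continuous (toF1USCG : F1USCGp X p → F1USCG X) := by
  have hp0 : 0 < p := by linarith [hp.out]
  rw [EMetric.continuous_iff]
  intro v ε hε
  obtain ⟨r, hr0, hr⟩ := ENNReal.lt_iff_exists_real_btwn.1 hε
  have hr₀ := ENNReal.ofReal_pos.1 hr.1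
  refine ⟨(ENNReal.ofReal (r / 2) ^ p * ENNReal.ofReal (r / 2)) ^ (1 / p), ?_, fun u hu => ?_⟩
  · have : 0 < ENNReal.ofReal (r / 2) := ENNReal.ofReal_pos.2 (by linarith)
    have h₂ := ENNReal.rpow_pos this ENNReal.ofReal_ne_top (p := p)
    exact ENNReal.rpow_pos_of_nonneg (ENNReal.mul_pos h₂.ne' this.ne') (by positivity)
  · refine lt_of_le_of_lt ?_ hr.2
    rw [edist_F1USCGp] at hu
    have h2 : r = 2 * (r / 2) := by ring
    rw [h2]
    refine hausdorffEDist_le_of_infEDist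
      (fun z hz => infEDist_endograph_le hp0 (by linarith) hu hz)
      (fun z hz => infEDist_endograph_le hp0 (by linarith) (dp_comm p u.1 v.1 ▸ hu) hz)

end Metrics

/-! ### Consequences of compactness in the endograph metric -/

variable {X : Type*} [MetricSpace X] {p : ℝ}

theorem exists_mem_edist_le_infEDist_add {Z : Type*} [PseudoEMetricSpace Z] {s : Set Z}
    (hs : s.Nonempty) (z : Z) {δ : ℝ≥0∞} (hδ : δ ≠ 0) :
    ∃ y ∈ s, edist z y ≤ infEDist z s + δ := by
  rcases eq_or_ne (infEDist z s) ∞ with h | h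
  · exact ⟨hs.some, hs.some_mem, by simp [h]⟩
  · obtain ⟨y, hy, hlt⟩ := infEDist_lt_iff.1 (ENNReal.lt_add_right h hδ)
    exact ⟨y, hy, hlt.le⟩

theorem isCompact_cutUnion {U : Set (F1USCGp X p)} (hU : IsCompact (toF1USCG '' U)) {α : ℝ}
    (hα : α ∈ Ioc (0 : ℝ) 1) : IsCompact (cutUnion U α) := by
  rw [isCompact_iff_isSeqCompact]
  intro x hx
  choose u hu hxu using fun n => mem_iUnion₂.1 (hx n)
  obtain ⟨_, ⟨v, hv, rfl⟩, φ, hφ, hlim⟩ :=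
    hU.isSeqCompact (x := fun n => toF1USCG (u n)) fun n => mem_image_of_mem _ (hu n)
  rw [tendsto_iff_edist_tendsto_0] at hlim
  let α' : unitInterval := ⟨α, hα.1.le, hα.2⟩
  let z : ℕ → WithLp 1 (X × unitInterval) := fun n => WithLp.toLp 1 (x (φ n), α')
  have hz : ∀ n, z n ∈ endograph (u (φ n)).1 := fun n => by
    have := hxu (φ n)
    rw [cut_of_pos _ hα.1] at this
    exact this
  obtain ⟨x₁, hx₁⟩ := (v.2.1 α hα).1
  rw [cut_of_pos _ hα.1] at hx₁
  have hne : (endograph v.1).Nonempty := ⟨WithLp.toLp 1 (x₁, α'), hx₁⟩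
  -- The slack `1/n` stands in for an attained infimum; at `n = 0` it is `∞`, which is harmless.
  choose y hy hzy using fun n : ℕ => exists_mem_edist_le_infEDist_add hne (z n)
    (δ := ((n : ℝ≥0∞))⁻¹) (by simp)
  have hzy₀ : Tendsto (fun n => edist (z n) (y n)) atTop (𝓝 0) := by
    have hsum := hlim.add ENNReal.tendsto_inv_nat_nhds_zero
    rw [add_zero] at hsum
    refine tendsto_of_tendsto_of_tendsto_of_le_of_le tendsto_const_nhds hsum
      (fun _ => zero_le) fun n => (hzy n).trans ?_
    gcongr
    exact infEDist_le_hausdorffEDist_of_mem (hz n)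
  have hfst : Tendsto (fun n => edist (x (φ n)) (y n).fst) atTop (𝓝 0) :=
    tendsto_of_tendsto_of_tendsto_of_le_of_le tendsto_const_nhds hzy₀ (fun _ => zero_le)
      fun n => by rw [edist_withLp_one]; exact le_self_add
  have hsnd : Tendsto (fun n => (y n).snd) atTop (𝓝 α') := by
    rw [tendsto_iff_edist_tendsto_0]
    refine tendsto_of_tendsto_of_tendsto_of_le_of_le tendsto_const_nhds hzy₀ (fun _ => zero_le)
      fun n => ?_
    simp only
    rw [edist_withLp_one, edist_comm]
    exact le_add_self
  have hhalf : α / 2 ∈ Ioc (0 : ℝ) 1 := ⟨by linarith [hα.1], by linarith [hα.1, hα.2]⟩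
  -- The heights of `y n` tend to `α`, hence eventually exceed `α / 2`, which confines the base
  -- points to one compact cut of `v`.
  have hmem : ∀ᶠ n in atTop, (y n).fst ∈ cut v.1 (α / 2) := by
    have h₁ : Tendsto (fun n => ((y n).snd : ℝ)) atTop (𝓝 α) :=
      (continuous_subtype_val.tendsto α').comp hsnd
    filter_upwards [h₁.eventually_const_le (show α / 2 < α by linarith [hα.1])] with n hn
    rw [cut_of_pos _ hhalf.1]
    exact hn.trans (Subtype.coe_le_coe.2 (hy n))
  obtain ⟨a, -, ψ, hψ, ha⟩ := (v.2.1 _ hhalf).2.tendsto_subseq' hmem.frequently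
  have hcont : Continuous fun q : X × unitInterval => (WithLp.toLp 1 q : WithLp 1 _) :=
    WithLp.prod_continuous_toLp 1 X unitInterval
  have hav : WithLp.toLp 1 (a, α') ∈ endograph v.1 :=
    (isClosed_endograph v.2.1).mem_of_tendsto
      ((hcont.tendsto _).comp (ha.prodMk_nhds (hsnd.comp hψ.tendsto_atTop)))
      (Eventually.of_forall fun n => hy (ψ n))
  refine ⟨a, mem_iUnion₂.2 ⟨v, hv, ?_⟩, φ ∘ ψ, hφ.comp hψ, ?_⟩
  · rw [cut_of_pos _ hα.1]
    exact hav
  · rw [tendsto_iff_edist_tendsto_0] at ha ⊢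
    have hsum := (hfst.comp hψ.tendsto_atTop).add ha
    rw [add_zero] at hsum
    exact tendsto_of_tendsto_of_tendsto_of_le_of_le tendsto_const_nhds hsum (fun _ => zero_le)
      fun n => edist_triangle _ _ _

theorem isClosed_of_isCompact_image [Fact (1 ≤ p)] {U : Set (F1USCGp X p)}
    (hU : IsCompact (toF1USCG '' U)) : IsClosed U := by
  rw [← toF1USCG_injective.preimage_image U]
  exact hU.isClosed.preimage continuous_toF1USCG

/-! ### Shifts of the level and `p`-mean left-continuity -/

/-- The `L^p` norm of the variation of the cuts of `u` under a shift of the level by `h`. -/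
noncomputable def shiftNorm (p : ℝ) (u : FuzzySet X) (h : ℝ) : ℝ≥0∞ :=
  levelNorm p (Icc h 1) fun α => hausdorffEDist (cut u α) (cut u (α - h))

theorem setLIntegral_shift (f : ℝ → ℝ≥0∞) (h a b : ℝ) :
    ∫⁻ α in Icc (a + h) (b + h), f (α - h) = ∫⁻ α in Icc a b, f α := by
  rw [← (measurePreserving_sub_right volume h).setLIntegral_comp_preimage_emb
    (measurableEmbedding_subRight h) f (Icc a b), preimage_sub_const_Icc]

theorem levelNorm_shift (f : ℝ → ℝ≥0∞) (h b : ℝ) :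
    levelNorm p (Icc h b) (fun α => f (α - h)) = levelNorm p (Icc 0 (b - h)) f := by
  have := setLIntegral_shift (fun α => f α ^ p) h 0 (b - h)
  rw [zero_add, sub_add_cancel] at this
  rw [levelNorm, levelNorm, this]

theorem aemeasurable_hausdorffEDist_cut_sub_sub {u v : FuzzySet X} (hu : u ∈ F1USCG X)
    (hv : v ∈ F1USCG X) {h : ℝ} (hh : 0 ≤ h) :
    AEMeasurable (fun α => hausdorffEDist (cut u (α - h)) (cut v (α - h)))
      (volume.restrict (Icc h 1)) :=
  aemeasurable_of_tendsto_left fun α hα => by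
    have hαh : α - h ∈ Ioc (0 : ℝ) 1 := ⟨by linarith [hα.1], by linarith [hα.2]⟩
    exact (tendsto_hausdorffEDist
      ((tendsto_cut_left hu hαh).comp (tendsto_sub_nhdsLE h α))
      ((tendsto_cut_left hv hαh).comp (tendsto_sub_nhdsLE h α))).mono_left
      (nhdsWithin_mono _ Iio_subset_Iic_self)

/-- Go from `u` to `v` at level `α`, along `v` down to `α - h`, and back to `u`. The last leg is a
translate of the integrand of `dp`. -/
theorem shiftNorm_le (hp : 1 ≤ p) {u v : FuzzySet X} (hu : u ∈ F1USCG X) (hv : v ∈ F1USCG X)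
    {h : ℝ} (hh : 0 ≤ h) : shiftNorm p u h ≤ dp p u v + (shiftNorm p v h + dp p u v) := by
  have hp0 : 0 ≤ p := by linarith
  have h₁ := levelNorm_le_add (f := fun α => hausdorffEDist (cut u α) (cut u (α - h))) hp
    measurableSet_Icc (aemeasurable_hausdorffEDist_cut hu hv hh le_rfl)
    ((aemeasurable_hausdorffEDist_cut_sub hv hh le_rfl le_rfl).add
      (aemeasurable_hausdorffEDist_cut_sub_sub hv hu hh)) fun α _ =>
      hausdorffEDist_triangle.trans (add_le_add_right hausdorffEDist_triangle _)
  refine h₁.trans (add_le_add (levelNorm_mono_set hp0 (Icc_subset_Icc_left hh))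
    ((levelNorm_le_add hp measurableSet_Icc
      (aemeasurable_hausdorffEDist_cut_sub hv hh le_rfl le_rfl)
      (aemeasurable_hausdorffEDist_cut_sub_sub hv hu hh) fun _ _ => le_rfl).trans
      (add_le_add_right ?_ _)))
  rw [levelNorm_shift (fun α => hausdorffEDist (cut v α) (cut u α)), dp_comm]
  exact levelNorm_mono_set hp0 (Icc_subset_Icc_right (by linarith))

theorem cut_crisp_singleton (x₀ : X) {α : ℝ} (hα : α ∈ Ioc (0 : ℝ) 1) :
    cut (crisp {x₀}) α = {x₀} := by
  rw [cut_of_pos _ hα.1]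
  ext x
  by_cases hx : x = x₀
  · simp [crisp, hx, hα.2]
  · simp [crisp, hx, hα.1]

theorem crisp_singleton_mem (x₀ : X) : crisp {x₀} ∈ F1USCG X := fun α hα => by
  rw [cut_crisp_singleton x₀ hα]
  exact ⟨singleton_nonempty x₀, isCompact_singleton⟩

/-- Both cuts lie in the larger one, whose diameter is at most twice its distance to `x₀`. This
bound involves only the lower level `β`. -/
theorem hausdorffEDist_cut_cut_le {u : FuzzySet X} (hu : u ∈ F1USCG X) (x₀ : X) {α β : ℝ}
    (hβ : 0 < β) (hβα : β ≤ α) (hα : α ≤ 1) :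
    hausdorffEDist (cut u α) (cut u β) ≤ 2 * hausdorffEDist (cut u β) (cut (crisp {x₀}) β) := by
  have hd : ∀ x ∈ cut u β, edist x x₀ ≤ hausdorffEDist (cut u β) (cut (crisp {x₀}) β) :=
    fun x hx => by
      have := infEDist_le_hausdorffEDist_of_mem (t := cut (crisp {x₀}) β) hx
      rwa [cut_crisp_singleton x₀ ⟨hβ, hβα.trans hα⟩, infEDist_singleton,
        ← cut_crisp_singleton x₀ ⟨hβ, hβα.trans hα⟩] at this
  obtain ⟨y, hy⟩ := (hu α ⟨hβ.trans_le hβα, hα⟩).1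
  refine hausdorffEDist_le_of_subset (cut_anti u hβ hβα) fun x hx => ?_
  calc infEDist x (cut u α) ≤ edist x y := infEDist_le_edist_of_mem hy
    _ ≤ edist x x₀ + edist y x₀ := edist_triangle_right _ _ _
    _ ≤ _ := by rw [two_mul]; exact add_le_add (hd x hx) (hd y (cut_anti u hβ hβα hy))

theorem tendsto_setLIntegral_cut_sub {u : FuzzySet X} (hp : 0 < p) (hu : u ∈ F1USCG X) {η : ℝ}
    (hη : 0 < η) : Tendsto (fun h => ∫⁻ α in Icc η 1, hausdorffEDist (cut u α) (cut u (α - h)) ^ p)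
      (𝓝[≥] 0) (𝓝 0) := by
  rcases lt_or_ge 1 η with hη1 | hη1
  · simp [Icc_eq_empty hη1.not_ge]
  have hhalf : η / 2 ∈ Ioc (0 : ℝ) 1 := ⟨by linarith, by linarith⟩
  have hsmall : ∀ᶠ h in 𝓝[≥] (0 : ℝ), 0 ≤ h ∧ h < η / 2 := Ico_mem_nhdsGE hhalf.1
  have hlim := tendsto_lintegral_filter_of_dominated_convergence' (l := 𝓝[≥] (0 : ℝ))
    (μ := volume.restrict (Icc η 1))
    (F := fun h α => hausdorffEDist (cut u α) (cut u (α - h)) ^ p) (f := fun _ => 0)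
    -- For `h < η / 2` the two cuts are nested between those at `1` and `η / 2`, which gives a
    -- finite constant majorant.
    (fun _ => hausdorffEDist (cut u 1) (cut u (η / 2)) ^ p) ?_ ?_ ?_ ?_
  · simpa using hlim
  · filter_upwards [hsmall] with h hh
    exact (aemeasurable_hausdorffEDist_cut_sub hu hh.1 (by linarith) le_rfl).pow_const p
  · filter_upwards [hsmall] with h hh
    refine (ae_restrict_iff' measurableSet_Icc).2 (Eventually.of_forall fun α hα => ?_)
    have h1 : η / 2 ≤ α - h := by linarith [hα.1]
    have h2 : 0 < α - h := by linarith
    exact ENNReal.rpow_le_rpow (hausdorffEDist_le_of_nested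
      (cut_anti u (by linarith) hα.2) (cut_anti u h2 (by linarith)) (cut_anti u hhalf.1 h1)) hp.le
  · have := ENNReal.rpow_ne_top_of_nonneg hp.le
      (hausdorffEDist_cut_ne_top hu hu ⟨one_pos, le_rfl⟩ hhalf)
    simpa using ENNReal.mul_ne_top this ENNReal.ofReal_ne_top
  · refine (ae_restrict_iff' measurableSet_Icc).2 (Eventually.of_forall fun α hα => ?_)
    have hα' : α ∈ Ioc (0 : ℝ) 1 := ⟨by linarith [hα.1], hα.2⟩
    have ht : Tendsto (fun h : ℝ => α - h) (𝓝[≥] 0) (𝓝[≤] α) := by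
      refine tendsto_nhdsWithin_iff.2 ⟨?_, ?_⟩
      · have : Tendsto (fun h : ℝ => α - h) (𝓝 0) (𝓝 (α - 0)) :=
          (continuous_const.sub continuous_id).tendsto 0
        rw [sub_zero] at this
        exact this.mono_left nhdsWithin_le_nhds
      · filter_upwards [self_mem_nhdsWithin] with h hh
        exact sub_le_self α hh
    have h₀ := ((ENNReal.continuous_rpow_const (y := p)).tendsto _).comp
      ((tendsto_cut_left hu hα').comp ht)
    rw [ENNReal.zero_rpow_of_pos hp] at h₀
    refine h₀.congr fun h => ?_
    simp only [Function.comp_apply]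
    rw [hausdorffEDist_comm]

/-- Every fuzzy set in `F1USCGp X p` is `p`-mean left-continuous. -/
theorem tendsto_shiftNorm (hp : 1 ≤ p) {u : FuzzySet X} (hu : u ∈ F1USCGp X p) :
    Tendsto (shiftNorm p u) (𝓝[≥] 0) (𝓝 0) := by
  have hp0 : 0 < p := by linarith
  obtain ⟨hu, x₀, hfin⟩ := hu
  suffices h : Tendsto (fun h => ∫⁻ α in Icc h 1, hausdorffEDist (cut u α) (cut u (α - h)) ^ p)
      (𝓝[≥] 0) (𝓝 0) by
    have h₀ := ((ENNReal.continuous_rpow_const (y := 1 / p)).tendsto _).comp h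
    rwa [ENNReal.zero_rpow_of_pos (by positivity)] at h₀
  -- `g (α - h)` dominates the variation at low levels, so absolute continuity of the integral of `g
  -- ^ p` handles `[h, η]` uniformly in `h`; dominated convergence handles `[η, 1]`.
  set g := fun α => 2 * hausdorffEDist (cut u α) (cut (crisp {x₀}) α) with hg
  have hgfin : ∫⁻ α in Icc (0 : ℝ) 1, g α ^ p ≠ ∞ := by
    simp only [hg, ENNReal.mul_rpow_of_nonneg _ _ hp0.le]
    rw [lintegral_const_mul' _ _ (by simp)]
    refine ENNReal.mul_ne_top (by simp) fun h => hfin.ne ?_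
    rw [dp, h, ENNReal.top_rpow_of_pos (by positivity)]
  rw [ENNReal.tendsto_nhds_zero]
  intro ε hε
  obtain ⟨δ, hδ, hsmall⟩ :=
    exists_pos_setLIntegral_lt_of_measure_lt hgfin (ENNReal.half_pos hε.ne').ne'
  obtain ⟨η, hη0, hη⟩ := ENNReal.lt_iff_exists_real_btwn.1 (lt_min hδ one_pos)
  have hη' : 0 < η := ENNReal.ofReal_pos.1 hη.1
  have hη1 : η < 1 := by simpa using (hη.2.trans_le (min_le_right _ _))
  have hgη : ∫⁻ α in Icc 0 η, g α ^ p ≤ ε / 2 := by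
    have := hsmall (Icc 0 η) (by
      refine (Measure.restrict_apply_le _ _).trans_lt ?_
      simpa using hη.2.trans_le (min_le_left _ _))
    rw [Measure.restrict_restrict measurableSet_Icc,
      inter_eq_left.2 (Icc_subset_Icc_right hη1.le)] at this
    exact this.le
  filter_upwards [(ENNReal.tendsto_nhds_zero.1 (tendsto_setLIntegral_cut_sub hp0 hu hη'))
    (ε / 2) (ENNReal.half_pos hε.ne'), Ico_mem_nhdsGE hη'] with h hbig hh
  have hfirst : ∫⁻ α in Icc h η, hausdorffEDist (cut u α) (cut u (α - h)) ^ p ≤ ε / 2 := by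
    have hshift := setLIntegral_shift (fun α => g α ^ p) h 0 (η - h)
    rw [zero_add, sub_add_cancel] at hshift
    -- The endpoint `α = h` is discarded because there `α - h = 0` and the cut is the support.
    calc ∫⁻ α in Icc h η, hausdorffEDist (cut u α) (cut u (α - h)) ^ p
        = ∫⁻ α in Ioc h η, hausdorffEDist (cut u α) (cut u (α - h)) ^ p := by
          rw [Measure.restrict_congr_set Ioc_ae_eq_Icc]
      _ ≤ ∫⁻ α in Ioc h η, g (α - h) ^ p := setLIntegral_mono' measurableSet_Ioc fun α hα =>
          ENNReal.rpow_le_rpow (hausdorffEDist_cut_cut_le hu x₀ (by linarith [hα.1])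
            (by linarith [hh.1]) (hα.2.trans hη1.le)) hp0.le
      _ ≤ ∫⁻ α in Icc h η, g (α - h) ^ p := lintegral_mono_set Ioc_subset_Icc_self
      _ = ∫⁻ α in Icc 0 (η - h), g α ^ p := hshift
      _ ≤ ∫⁻ α in Icc 0 η, g α ^ p :=
          lintegral_mono_set (Icc_subset_Icc_right (by linarith [hh.1]))
      _ ≤ ε / 2 := hgη
  calc ∫⁻ α in Icc h 1, hausdorffEDist (cut u α) (cut u (α - h)) ^ p
      ≤ ∫⁻ α in Icc h η ∪ Icc η 1, hausdorffEDist (cut u α) (cut u (α - h)) ^ p :=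
        lintegral_mono_set Icc_subset_Icc_union_Icc
    _ ≤ _ := lintegral_union_le _ _ _
    _ ≤ ε / 2 + ε / 2 := add_le_add hfirst hbig
    _ = ε := ENNReal.add_halves ε

theorem pMeanEquiLeftContinuous_of_eventually {U : Set (F1USCGp X p)}
    (hU : ∀ ε : ℝ≥0∞, 0 < ε → ∀ᶠ h in 𝓝[≥] (0 : ℝ), ∀ u ∈ U, shiftNorm p u.1 h < ε) :
    PMeanEquiLeftContinuous U := by
  intro ε hε
  obtain ⟨δ, hδ, hsub⟩ := (mem_nhdsGE_iff_exists_Ico_subset).1 (hU _ (ENNReal.ofReal_pos.2 hε))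
  exact ⟨min δ 1, ⟨lt_min hδ one_pos, min_le_right _ _⟩, fun h h₀ hh u hu =>
    hsub ⟨h₀, hh.trans_le (min_le_left _ _)⟩ u hu⟩

theorem pMeanEquiLeftContinuous_of_isCompact [hp : Fact (1 ≤ p)] {U : Set (F1USCGp X p)}
    (hU : IsCompact U) : PMeanEquiLeftContinuous U := by
  refine pMeanEquiLeftContinuous_of_eventually fun ε hε => ?_
  have hε4 : 0 < ε / 2 / 2 := ENNReal.half_pos (ENNReal.half_pos hε.ne').ne'
  obtain ⟨t, ht, hcov⟩ := EMetric.totallyBounded_iff.1 hU.totallyBounded _ hε4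
  have hev : ∀ᶠ h in 𝓝[≥] (0 : ℝ), ∀ v ∈ t, shiftNorm p v.1 h < ε / 2 :=
    (eventually_all_finite ht).2 fun v _ =>
      (tendsto_shiftNorm hp.out v.2).eventually_lt_const (ENNReal.half_pos hε.ne')
  filter_upwards [hev, self_mem_nhdsWithin] with h hlt hh u hu
  obtain ⟨v, hv, huv⟩ := mem_iUnion₂.1 (hcov hu)
  have huv' : dp p u.1 v.1 < ε / 2 / 2 := huv
  calc shiftNorm p u.1 h ≤ dp p u.1 v.1 + (shiftNorm p v.1 h + dp p u.1 v.1) :=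
        shiftNorm_le hp.out u.2.1 v.2.1 hh
    _ < ε / 2 / 2 + (ε / 2 + ε / 2 / 2) :=
        ENNReal.add_lt_add huv' (ENNReal.add_lt_add (hlt v hv) huv')
    _ = ε := by
        rw [add_comm (ε / 2), ← add_assoc, ENNReal.add_halves, ENNReal.add_halves]

/-! ### Extraction of a subsequence converging at almost every level -/

theorem subset_of_tendsto_hausdorffEDist {A B : ℕ → Set X} {A₀ B₀ : Set X} (hB₀ : IsClosed B₀)
    (hAB : ∀ n, A n ⊆ B n)
    (hA : Tendsto (fun n => hausdorffEDist (A n) A₀) atTop (𝓝 0))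
    (hB : Tendsto (fun n => hausdorffEDist (B n) B₀) atTop (𝓝 0)) : A₀ ⊆ B₀ := by
  intro x hx
  rw [mem_iff_infEDist_zero_of_closed hB₀]
  have hsum := hA.add hB
  rw [add_zero] at hsum
  refine le_antisymm (ge_of_tendsto' hsum fun n => ?_) zero_le
  calc infEDist x B₀ ≤ infEDist x (B n) + hausdorffEDist (B n) B₀ :=
        infEDist_le_infEDist_add_hausdorffEDist
    _ ≤ hausdorffEDist (A n) A₀ + hausdorffEDist (B n) B₀ := by
        gcongr
        rw [hausdorffEDist_comm]
        exact (infEDist_anti (hAB n)).trans (infEDist_le_hausdorffEDist_of_mem hx)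

/-- The rational levels in `(0,1]`. -/
abbrev RatLevel : Type := {q : ℚ // (q : ℝ) ∈ Ioc (0 : ℝ) 1}

theorem exists_ratLevel_btwn {a b : ℝ} (ha : 0 ≤ a) (hb : b ≤ 1) (hab : a < b) :
    ∃ q : RatLevel, a < (q.1 : ℝ) ∧ (q.1 : ℝ) < b := by
  obtain ⟨q, haq, hqb⟩ := exists_rat_btwn hab
  exact ⟨⟨q, ha.trans_lt haq, (hqb.trans_le hb).le⟩, haq, hqb⟩

/-- A decreasing family of nonempty compact sets indexed by the rational levels determines a fuzzy
set whose cuts are the intersections of the sets of lower level. -/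
theorem exists_fuzzySet_of_antitone (K : RatLevel → Set X) (hne : ∀ q, (K q).Nonempty)
    (hK : ∀ q, IsCompact (K q)) (hanti : ∀ q r : RatLevel, (q.1 : ℝ) ≤ r.1 → K r ⊆ K q) :
    ∃ v ∈ F1USCG X, ∀ α ∈ Ioc (0 : ℝ) 1,
      cut v α = ⋂ q : {q : RatLevel // (q.1 : ℝ) < α}, K q.1 := by
  -- The value at `x` is the supremum of the levels `q` with `x ∈ K q`; inserting `0` covers the
  -- points lying in no `K q`.
  let T : X → Set ℝ := fun x => insert 0 {t | ∃ q : RatLevel, (q.1 : ℝ) = t ∧ x ∈ K q}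
  have hT1 : ∀ x, ∀ t ∈ T x, t ≤ 1 := by
    rintro x t (rfl | ⟨q, rfl, -⟩)
    · exact zero_le_one
    · exact q.2.2
  have hTb : ∀ x, BddAbove (T x) := fun x => ⟨1, hT1 x⟩
  have hT0 : ∀ x, (0 : ℝ) ∈ T x := fun x => mem_insert _ _
  let v : FuzzySet X := fun x => ⟨sSup (T x), le_csSup (hTb x) (hT0 x),
    csSup_le ⟨0, hT0 x⟩ (hT1 x)⟩
  have hcut : ∀ α ∈ Ioc (0 : ℝ) 1,
      cut v α = ⋂ q : {q : RatLevel // (q.1 : ℝ) < α}, K q.1 := by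
    intro α hα
    rw [cut_of_pos v hα.1]
    ext x
    rw [mem_iInter]
    constructor
    · rintro hx ⟨q, hq⟩
      have hlt : (q.1 : ℝ) < sSup (T x) := hq.trans_le hx
      obtain ⟨t, ht, hqt⟩ := exists_lt_of_lt_csSup ⟨0, hT0 x⟩ hlt
      rcases ht with rfl | ⟨r, rfl, hr⟩
      · exact absurd hqt q.2.1.not_gt
      · exact hanti q r hqt.le hr
    · intro hx
      change α ≤ sSup (T x)
      refine le_of_forall_lt fun β hβ => ?_
      obtain ⟨q, hq, hqα⟩ := exists_ratLevel_btwn (le_max_right β 0) hα.2 (max_lt hβ hα.1)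
      exact ((le_max_left _ _).trans_lt hq).trans_le
        (le_csSup (hTb x) (Or.inr ⟨q, rfl, hx ⟨q, hqα⟩⟩))
  refine ⟨v, fun α hα => ?_, hcut⟩
  rw [hcut α hα]
  obtain ⟨q₀, -, hq₀⟩ := exists_ratLevel_btwn le_rfl hα.2 hα.1
  have : Nonempty {q : RatLevel // (q.1 : ℝ) < α} := ⟨⟨q₀, hq₀⟩⟩
  constructor
  · refine IsCompact.nonempty_iInter_of_directed_nonempty_isCompact_isClosed _ ?_
      (fun q => hne q.1) (fun q => hK q.1) fun q => (hK q.1).isClosed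
    intro q r
    rcases le_total (q.1.1 : ℝ) r.1.1 with h | h
    · exact ⟨r, hanti _ _ h, subset_rfl⟩
    · exact ⟨q, subset_rfl, hanti _ _ h⟩
  · exact (hK q₀).of_isClosed_subset (isClosed_iInter fun q => (hK q.1).isClosed)
      (iInter_subset (fun q : {q : RatLevel // (q.1 : ℝ) < α} => K q.1) ⟨q₀, hq₀⟩)

/-- A sequence of fuzzy sets whose cuts stay in compact sets has a subsequence whose cuts converge
at almost every level. -/
theorem exists_subseq_ae_tendsto_cut {u : ℕ → FuzzySet X} (hu : ∀ n, u n ∈ F1USCG X)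
    {C : ℝ → Set X} (hC : ∀ α ∈ Ioc (0 : ℝ) 1, IsCompact (C α))
    (huC : ∀ n, ∀ α ∈ Ioc (0 : ℝ) 1, cut (u n) α ⊆ C α) :
    ∃ φ : ℕ → ℕ, StrictMono φ ∧ ∃ v ∈ F1USCG X, ∀ᵐ α ∂(volume.restrict (Icc (0 : ℝ) 1)),
      Tendsto (fun n => hausdorffEDist (cut (u (φ n)) α) (cut v α)) atTop (𝓝 0) := by
  let w : ℕ → RatLevel → TopologicalSpace.NonemptyCompacts X := fun n q =>
    ⟨⟨cut (u n) q.1, (hu n q.1 q.2).2⟩, (hu n q.1 q.2).1⟩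
  -- Tychonoff over the countably many rational levels replaces a diagonal argument.
  have hS : IsCompact (univ.pi fun q : RatLevel =>
      {K : TopologicalSpace.NonemptyCompacts X | (K : Set X) ⊆ C q.1}) :=
    isCompact_univ_pi fun q =>
      TopologicalSpace.NonemptyCompacts.isCompact_subsets_of_isCompact (hC q.1 q.2)
  obtain ⟨K, -, φ, hφ, hlim⟩ := hS.isSeqCompact (x := w) fun n q _ => huC n q.1 q.2
  have hlim' : ∀ q : RatLevel, Tendsto
      (fun n => hausdorffEDist (cut (u (φ n)) q.1) (K q : Set X)) atTop (𝓝 0) := fun q =>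
    tendsto_iff_edist_tendsto_0.1 (tendsto_pi_nhds.1 hlim q)
  have hanti : ∀ q r : RatLevel, (q.1 : ℝ) ≤ r.1 → (K r : Set X) ⊆ K q := fun q r hqr =>
    subset_of_tendsto_hausdorffEDist (K q).isCompact.isClosed
      (fun n => cut_anti _ q.2.1 hqr) (hlim' r) (hlim' q)
  obtain ⟨v, hv, hcut⟩ := exists_fuzzySet_of_antitone (fun q => (K q : Set X))
    (fun q => (K q).nonempty) (fun q => (K q).isCompact) hanti
  have hle : ∀ q : RatLevel, ∀ α ∈ Ioc (0 : ℝ) 1, (q.1 : ℝ) < α → cut v α ⊆ K q :=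
    fun q α hα hq => by
      rw [hcut α hα]
      exact iInter_subset (fun r : {r : RatLevel // (r.1 : ℝ) < α} => (K r.1 : Set X)) ⟨q, hq⟩
  have hge : ∀ q : RatLevel, ∀ α ∈ Ioc (0 : ℝ) 1, α ≤ q.1 → (K q : Set X) ⊆ cut v α :=
    fun q α hα hq => by
      rw [hcut α hα]
      exact subset_iInter fun r => hanti _ _ (r.2.le.trans hq)
  refine ⟨φ, hφ, v, hv, ?_⟩
  filter_upwards [ae_exists_hausdorffEDist_cut_lt hv] with α ⟨hα, hα'⟩
  rw [ENNReal.tendsto_nhds_zero]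
  intro ε hε
  obtain ⟨β, hβ, γ, hγ, hlt⟩ := hα' (ε / 2) (ENNReal.half_pos hε.ne')
  -- Rational levels `β < q < α < r < γ` sandwich the cut at `α`, and the limit sets at `q` and `r`
  -- are close because `v` barely varies between `β` and `γ`.
  obtain ⟨q, hβq, hqα⟩ := exists_ratLevel_btwn hβ.1.le hα.2.le hβ.2
  obtain ⟨r, hαr, hrγ⟩ := exists_ratLevel_btwn hα.1.le hγ.2 hγ.1
  have hK : hausdorffEDist (K r : Set X) (K q) ≤ ε / 2 :=
    (hausdorffEDist_le_of_nested (hle r γ ⟨hα.1.trans hγ.1, hγ.2⟩ hrγ)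
      (hanti q r (hqα.trans hαr).le) (hge q β ⟨hβ.1, (hβ.2.trans hα.2).le⟩ hβq.le)).trans hlt.le
  have hsum := (hlim' r).add (hlim' q)
  rw [add_zero] at hsum
  filter_upwards [(ENNReal.tendsto_nhds_zero.1 hsum) (ε / 2) (ENNReal.half_pos hε.ne')] with n hn
  calc hausdorffEDist (cut (u (φ n)) α) (cut v α)
      = hausdorffEDist (cut v α) (cut (u (φ n)) α) := hausdorffEDist_comm
    _ ≤ hausdorffEDist (K r : Set X) (K q) + (hausdorffEDist (K r : Set X) (cut (u (φ n)) r.1) +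
          hausdorffEDist (K q : Set X) (cut (u (φ n)) q.1)) :=
        hausdorffEDist_le_of_sandwich (hge r α ⟨hα.1, hα.2.le⟩ hαr.le)
          (hle q α ⟨hα.1, hα.2.le⟩ hqα) (cut_anti _ hα.1 hαr.le) (cut_anti _ q.2.1 hqα.le)
    _ ≤ ε / 2 + ε / 2 := by
        refine add_le_add hK ?_
        rwa [hausdorffEDist_comm (s := (K r : Set X)), hausdorffEDist_comm (s := (K q : Set X))]
    _ = ε := ENNReal.add_halves ε

/-! ### From convergence at almost every level to `d_p`-convergence -/

theorem tendsto_levelNorm_hausdorffEDist_cut (hp : 0 < p) {u : ℕ → FuzzySet X} {v : FuzzySet X}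
    (hu : ∀ n, u n ∈ F1USCG X) (hv : v ∈ F1USCG X) {h : ℝ} (hh : h ∈ Ioc (0 : ℝ) 1) {C : Set X}
    (hC : IsCompact C) (huC : ∀ n, cut (u n) h ⊆ C)
    (hlim : ∀ᵐ α ∂(volume.restrict (Icc (0 : ℝ) 1)),
      Tendsto (fun n => hausdorffEDist (cut (u n) α) (cut v α)) atTop (𝓝 0)) :
    Tendsto (fun n => levelNorm p (Icc h 1) fun α => hausdorffEDist (cut (u n) α) (cut v α))
      atTop (𝓝 0) := by
  have hsub : Icc h 1 ⊆ Icc (0 : ℝ) 1 := Icc_subset_Icc_left hh.1.le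
  have hint := tendsto_lintegral_filter_of_dominated_convergence' (l := atTop)
    (μ := volume.restrict (Icc h 1))
    (F := fun n α => hausdorffEDist (cut (u n) α) (cut v α) ^ p) (f := fun _ => 0)
    (fun _ => ediam (C ∪ cut v h) ^ p) ?_ ?_ ?_ ?_
  · have h₀ := ((ENNReal.continuous_rpow_const (y := 1 / p)).tendsto _).comp hint
    rwa [lintegral_zero, ENNReal.zero_rpow_of_pos (by positivity)] at h₀
  · exact Eventually.of_forall fun n =>
      (aemeasurable_hausdorffEDist_cut (hu n) hv hh.1.le le_rfl).pow_const p
  · refine Eventually.of_forall fun n =>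
      (ae_restrict_iff' measurableSet_Icc).2 (Eventually.of_forall fun α hα => ?_)
    have hα' : α ∈ Ioc (0 : ℝ) 1 := ⟨hh.1.trans_le hα.1, hα.2⟩
    refine ENNReal.rpow_le_rpow ((hausdorffEDist_le_ediam (hu n α hα').1 (hv α hα').1).trans
      (ediam_mono (union_subset_union ?_ (cut_anti _ hh.1 hα.1)))) hp.le
    exact (cut_anti _ hh.1 hα.1).trans (huC n)
  · have hb : ediam (C ∪ cut v h) ≠ ∞ := (hC.union (hv h hh).2).isBounded.ediam_ne_top
    simpa using ENNReal.mul_ne_top (ENNReal.rpow_ne_top_of_nonneg hp.le hb) ENNReal.ofReal_ne_top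
  · filter_upwards [ae_mono (Measure.restrict_mono hsub le_rfl) hlim] with α hα
    have h₀ := ((ENNReal.continuous_rpow_const (y := p)).tendsto _).comp hα
    rwa [ENNReal.zero_rpow_of_pos hp] at h₀

theorem shiftNorm_le_of_ae_tendsto (hp : 0 < p) {u : ℕ → FuzzySet X} {v : FuzzySet X}
    (hu : ∀ n, u n ∈ F1USCG X) {h : ℝ} (hh : 0 ≤ h) {ε : ℝ≥0∞}
    (hε : ∀ n, shiftNorm p (u n) h ≤ ε)
    (hlim : ∀ᵐ α ∂(volume.restrict (Icc (0 : ℝ) 1)),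
      Tendsto (fun n => hausdorffEDist (cut (u n) α) (cut v α)) atTop (𝓝 0)) :
    shiftNorm p v h ≤ ε := by
  rw [shiftNorm, levelNorm_le_iff hp]
  have hlim' := (ae_restrict_iff' measurableSet_Icc).1 hlim
  have hconv : ∀ᵐ α ∂(volume.restrict (Icc h 1)),
      Tendsto (fun n => hausdorffEDist (cut (u n) α) (cut (u n) (α - h)) ^ p) atTop
        (𝓝 (hausdorffEDist (cut v α) (cut v (α - h)) ^ p)) := by
    rw [ae_restrict_iff' measurableSet_Icc]
    -- Translation preserves null sets, so for almost every `α` both `α` and `α - h` are levels of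
    -- convergence, and Fatou's lemma applies.
    filter_upwards [hlim', (measurePreserving_sub_right volume h).quasiMeasurePreserving.ae hlim']
      with α h₁ h₂ hα
    exact ((ENNReal.continuous_rpow_const (y := p)).tendsto _).comp
      (tendsto_hausdorffEDist (h₁ ⟨hh.trans hα.1, hα.2⟩)
        (h₂ ⟨by linarith [hα.1], by linarith [hα.2]⟩))
  calc ∫⁻ α in Icc h 1, hausdorffEDist (cut v α) (cut v (α - h)) ^ p
      = ∫⁻ α in Icc h 1,
          liminf (fun n => hausdorffEDist (cut (u n) α) (cut (u n) (α - h)) ^ p) atTop :=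
        lintegral_congr_ae (hconv.mono fun α hα => hα.liminf_eq.symm)
    _ ≤ liminf (fun n => ∫⁻ α in Icc h 1,
          hausdorffEDist (cut (u n) α) (cut (u n) (α - h)) ^ p) atTop :=
        lintegral_liminf_le' fun n =>
          (aemeasurable_hausdorffEDist_cut_sub (hu n) hh le_rfl le_rfl).pow_const p
    _ ≤ liminf (fun _ : ℕ => ε ^ p) atTop :=
        liminf_le_liminf (Eventually.of_forall fun n => (levelNorm_le_iff hp).1 (hε n))
    _ = ε ^ p := liminf_const _

theorem levelNorm_union_le (hp : 1 ≤ p) (s t : Set ℝ) (f : ℝ → ℝ≥0∞) :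
    levelNorm p (s ∪ t) f ≤ levelNorm p s f + levelNorm p t f := by
  have hp0 : 0 < p := by linarith
  exact (ENNReal.rpow_le_rpow (lintegral_union_le _ _ _) (by positivity)).trans
    (ENNReal.rpow_add_le_add_rpow _ _ (by positivity) (by rw [div_le_one hp0]; exact hp))

/-- The levels in `[0, 1 - h]` are translated up by `h` into `[h, 1]`, paying one shift norm for
each of `u` and `v`. The bound `h ≤ 1 / 2` makes `[0, 1 - h]` and `[h, 1]` cover `[0, 1]`. -/
theorem dp_le_shiftNorm_add (hp : 1 ≤ p) {u v : FuzzySet X} (hu : u ∈ F1USCG X)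
    (hv : v ∈ F1USCG X) {h : ℝ} (hh : 0 ≤ h) (hh' : h ≤ 1 / 2) :
    dp p u v ≤ shiftNorm p u h + shiftNorm p v h +
      2 * levelNorm p (Icc h 1) fun α => hausdorffEDist (cut u α) (cut v α) := by
  set f := fun α => hausdorffEDist (cut u α) (cut v α)
  have hsub : Icc (0 : ℝ) 1 ⊆ Icc 0 (1 - h) ∪ Icc h 1 := fun α hα => by
    rcases le_total α (1 - h) with h₁ | h₁
    · exact Or.inl ⟨hα.1, h₁⟩
    · exact Or.inr ⟨by linarith, hα.2⟩
  have hmu := aemeasurable_hausdorffEDist_cut_sub hu hh le_rfl le_rfl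
  have hmv := aemeasurable_hausdorffEDist_cut_sub hv hh le_rfl le_rfl
  have hmf := aemeasurable_hausdorffEDist_cut hu hv hh le_rfl
  have hlow : levelNorm p (Icc 0 (1 - h)) f ≤
      shiftNorm p u h + (levelNorm p (Icc h 1) f + shiftNorm p v h) := by
    rw [← levelNorm_shift f h 1]
    refine (levelNorm_le_add hp measurableSet_Icc hmu (hmf.add hmv) fun α _ => ?_).trans
      (add_le_add_right (levelNorm_le_add hp measurableSet_Icc hmf hmv fun _ _ => le_rfl) _)
    calc f (α - h) ≤ hausdorffEDist (cut u (α - h)) (cut u α) +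
          hausdorffEDist (cut u α) (cut v (α - h)) := hausdorffEDist_triangle
      _ ≤ _ := by
          rw [hausdorffEDist_comm (s := cut u (α - h))]
          exact add_le_add_right hausdorffEDist_triangle _
  calc dp p u v ≤ levelNorm p (Icc 0 (1 - h) ∪ Icc h 1) f :=
        levelNorm_mono_set (by linarith) hsub
    _ ≤ levelNorm p (Icc 0 (1 - h)) f + levelNorm p (Icc h 1) f := levelNorm_union_le hp _ _ _
    _ ≤ shiftNorm p u h + (levelNorm p (Icc h 1) f + shiftNorm p v h) +
          levelNorm p (Icc h 1) f := add_le_add_left hlow _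
    _ = _ := by ring

theorem PMeanEquiLeftContinuous.exists_shiftNorm_le {U : Set (F1USCGp X p)}
    (hU : PMeanEquiLeftContinuous U) {ε : ℝ≥0∞} (hε : 0 < ε) :
    ∃ h : ℝ, 0 < h ∧ h ≤ 1 / 2 ∧ ∀ u ∈ U, shiftNorm p u.1 h ≤ ε := by
  obtain ⟨r, hr0, hr⟩ := ENNReal.lt_iff_exists_real_btwn.1 hε
  obtain ⟨δ, hδ, hlt⟩ := hU r (ENNReal.ofReal_pos.1 hr.1)
  exact ⟨δ / 2, by linarith [hδ.1], by linarith [hδ.2], fun u hu =>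
    (hlt (δ / 2) (by linarith [hδ.1]) (by linarith [hδ.1]) u hu).le.trans hr.2.le⟩

theorem tendsto_dp_of_ae_tendsto_cut (hp : 1 ≤ p) {U : Set (F1USCGp X p)}
    (hU : ∀ α ∈ Ioc (0 : ℝ) 1, IsCompact (closure (cutUnion U α)))
    (hlc : PMeanEquiLeftContinuous U) {u : ℕ → F1USCGp X p} (hu : ∀ n, u n ∈ U) {v : FuzzySet X}
    (hv : v ∈ F1USCG X) (hlim : ∀ᵐ α ∂(volume.restrict (Icc (0 : ℝ) 1)),
      Tendsto (fun n => hausdorffEDist (cut (u n).1 α) (cut v α)) atTop (𝓝 0)) :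
    Tendsto (fun n => dp p (u n).1 v) atTop (𝓝 0) := by
  have hp0 : 0 < p := by linarith
  rw [ENNReal.tendsto_nhds_zero]
  intro ε hε
  have hε4 : 0 < ε / 2 / 2 := ENNReal.half_pos (ENNReal.half_pos hε.ne').ne'
  obtain ⟨h, hh, hh', hle⟩ := hlc.exists_shiftNorm_le hε4
  have hh1 : h ∈ Ioc (0 : ℝ) 1 := ⟨hh, by linarith⟩
  have hvle : shiftNorm p v h ≤ ε / 2 / 2 :=
    shiftNorm_le_of_ae_tendsto hp0 (fun n => (u n).2.1) hh.le (fun n => hle _ (hu n)) hlim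
  have hupper := tendsto_levelNorm_hausdorffEDist_cut hp0 (fun n => (u n).2.1) hv hh1 (hU h hh1)
    (fun n => (subset_biUnion_of_mem (u := fun w : F1USCGp X p => cut w.1 h) (hu n)).trans
      subset_closure) hlim
  filter_upwards [(ENNReal.tendsto_nhds_zero.1 hupper) _ hε4] with n hn
  calc dp p (u n).1 v ≤ shiftNorm p (u n).1 h + shiftNorm p v h + 2 * _ :=
        dp_le_shiftNorm_add hp (u n).2.1 hv hh.le hh'
    _ ≤ ε / 2 / 2 + ε / 2 / 2 + 2 * (ε / 2 / 2) := by
        gcongr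
        exact hle _ (hu n)
    _ = ε := by rw [two_mul, ENNReal.add_halves, ENNReal.add_halves]

theorem isCompact_of_isCompact_closure_cutUnion [hp : Fact (1 ≤ p)] {U : Set (F1USCGp X p)}
    (hU : ∀ α ∈ Ioc (0 : ℝ) 1, IsCompact (closure (cutUnion U α)))
    (hlc : PMeanEquiLeftContinuous U) (hclosed : IsClosed U) : IsCompact U := by
  refine IsSeqCompact.isCompact fun u hu => ?_
  obtain ⟨φ, hφ, v, hv, hlim⟩ := exists_subseq_ae_tendsto_cut (u := fun n => (u n).1)
    (fun n => (u n).2.1) hU fun n α _ =>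
      (subset_biUnion_of_mem (u := fun w : F1USCGp X p => cut w.1 α) (hu n)).trans subset_closure
  have hdp := tendsto_dp_of_ae_tendsto_cut hp.out hU hlc (u := u ∘ φ) (fun n => hu (φ n)) hv hlim
  -- One term at finite distance from `v` suffices to put `v` in the `p`-integrable space, as
  -- closedness of `U` there requires.
  obtain ⟨n, hn⟩ := (hdp.eventually_lt_const ENNReal.zero_lt_top).exists
  obtain ⟨x₀, hx₀⟩ := (u (φ n)).2.2
  have hvp : v ∈ F1USCGp X p := by
    refine ⟨hv, x₀, (dp_triangle hp.out hv (u (φ n)).2.1 (crisp_singleton_mem x₀)).trans_lt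
      (ENNReal.add_lt_top.2 ⟨?_, hx₀⟩)⟩
    rw [dp_comm]
    exact hn
  have htend : Tendsto (u ∘ φ) atTop (𝓝 (⟨v, hvp⟩ : F1USCGp X p)) :=
    tendsto_iff_edist_tendsto_0.2 hdp
  exact ⟨⟨v, hvp⟩, hclosed.mem_of_tendsto htend (Eventually.of_forall fun n => hu (φ n)), φ, hφ,
    htend⟩

end FuzzySpace

theorem theorem5p13 {X : Type*} [MetricSpace X] (p : ℝ) (hp : 1 ≤ p)
    (U : Set (FuzzySpace.F1USCGp X p)) :
    (IsCompact U ↔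
      IsCompact (FuzzySpace.toF1USCG '' U) ∧ FuzzySpace.PMeanEquiLeftContinuous U) ∧
    (IsCompact U ↔
      (∀ α ∈ Set.Ioc (0 : ℝ) 1, IsCompact (closure (FuzzySpace.cutUnion U α))) ∧
        FuzzySpace.PMeanEquiLeftContinuous U ∧ IsClosed U) ∧
    (IsCompact U ↔
      (∀ α ∈ Set.Ioc (0 : ℝ) 1, IsCompact (FuzzySpace.cutUnion U α)) ∧
        FuzzySpace.PMeanEquiLeftContinuous U ∧ IsClosed U) := by
  have := Fact.mk hp
  have h₁₂ : IsCompact U →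
      IsCompact (FuzzySpace.toF1USCG '' U) ∧ FuzzySpace.PMeanEquiLeftContinuous U := fun h =>
    ⟨h.image FuzzySpace.continuous_toF1USCG, FuzzySpace.pMeanEquiLeftContinuous_of_isCompact h⟩
  have h₂₄ : IsCompact (FuzzySpace.toF1USCG '' U) ∧ FuzzySpace.PMeanEquiLeftContinuous U →
      (∀ α ∈ Set.Ioc (0 : ℝ) 1, IsCompact (FuzzySpace.cutUnion U α)) ∧
        FuzzySpace.PMeanEquiLeftContinuous U ∧ IsClosed U := fun h =>
    ⟨fun α hα => FuzzySpace.isCompact_cutUnion h.1 hα, h.2,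
      FuzzySpace.isClosed_of_isCompact_image h.1⟩
  have h₄₃ : (∀ α ∈ Set.Ioc (0 : ℝ) 1, IsCompact (FuzzySpace.cutUnion U α)) ∧
        FuzzySpace.PMeanEquiLeftContinuous U ∧ IsClosed U →
      (∀ α ∈ Set.Ioc (0 : ℝ) 1, IsCompact (closure (FuzzySpace.cutUnion U α))) ∧
        FuzzySpace.PMeanEquiLeftContinuous U ∧ IsClosed U := fun h =>
    ⟨fun α hα => (h.1 α hα).closure, h.2⟩
  have h₃₁ : (∀ α ∈ Set.Ioc (0 : ℝ) 1, IsCompact (closure (FuzzySpace.cutUnion U α))) ∧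
        FuzzySpace.PMeanEquiLeftContinuous U ∧ IsClosed U → IsCompact U := fun h =>
    FuzzySpace.isCompact_of_isCompact_closure_cutUnion h.1 h.2.1 h.2.2
  exact ⟨⟨h₁₂, h₃₁ ∘ h₄₃ ∘ h₂₄⟩, ⟨h₄₃ ∘ h₂₄ ∘ h₁₂, h₃₁⟩, ⟨h₂₄ ∘ h₁₂, h₃₁ ∘ h₄₃⟩⟩
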